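/- Let $\mathcal X,\mathcal Y$ be finite alphabets and $\mathcal H$ a finite-dimensional complex Hilbert space; write $\mathcal S(\mathcal K)$ for the set of density operators on $\mathcal K$, $\mathcal P(A)$ for the set of probability distributions on a finite set $A$, and $[M]=\{1,\dots,M\}$. A classical-classical-quantum (CCQ) channel is an arbitrary family $\mathbf W=\{W^k:\mathcal X^k\times\mathcal Y^k\to\mathcal S(\mathcal H^{\otimes k})\}_{k\in\mathbb N}$ (not necessarily memoryless). Let $k\in\mathbb N$ and let $M,N\ge 1$ be integers. A deterministic $(k,M,N)$-code is a family $\mathcal C=(x_m,y_n,D_{mn})_{m\in[M],n\in[N]}$ with $x_m\in\mathcal X^k$, $y_n\in\mathcal Y^k$ and $(D_{mn})$ a POVM on $\mathcal H^{\otimes k}$ (that is, $D_{mn}\ge 0$ and $\sum_{m,n}D_{mn}=\mathbb 1$). Its average error is $$\bar e(\mathcal C,W^k)=1-\frac1{MN}\sum_{m\in[M]}\sum_{n\in[N]}\operatorname{tr}\bigl(D_{mn}W^k(x_m,y_n)\bigr).$$ A stochastic $(k,M,N)$-code is a family $\mathcal C=(P_m,Q_n,D_{mn})_{m\in[M],n\in[N]}$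 with $P_m\in\mathcal P(\mathcal X^k)$, $Q_n\in\mathcal P(\mathcal Y^k)$ and $(D_{mn})$ a POVM on $\mathcal H^{\otimes k}$. Its maximal error is $$e(\mathcal C,W^k)=\max_{m\in[M],\,n\in[N]}\Bigl(1-\sum_{x^k\in\mathcal X^k}\sum_{y^k\in\mathcal Y^k}P_m(x^k)\,Q_n(y^k)\operatorname{tr}\bigl(D_{mn}W^k(x^k,y^k)\bigr)\Bigr).$$ Let $C(\mathbf W)$ be the set of pairs $(R_1,R_2)\in\mathbb R^2$ with $R_1,R_2\ge 0$ such that for all $\epsilon,\delta>0$ there is a $k_0$ such that for every $k\ge k_0$ there are $M,N\ge 1$ and a deterministic $(k,M,N)$-code $\mathcal C$ with $$\tfrac1k\log_2 M\ge R_1-\delta,\qquad \tfrac1k\log_2 N\ge R_2-\delta,\qquad \bar e(\mathcal C,W^k)\le\epsilon .$$ Let $C_{\mathrm{st}}(\mathbf W)$ be defined in the same way with stochastic codes in place of deterministic codes and the maximal error $e$ in place of the average error $\bar e$. **Theorem.** For every CCQ channel $\mathbf W$, not necessarily discrete and memoryless, $$C(\mathbf W)\subseteq C_{\mathrm{st}}(\mathbf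 W).$$ -/

import Mathlib

open scoped ComplexOrder

noncomputable section

namespace CCQ

/-- Quantum states (density operators) on the Hilbert space with orthonormal basis `n`, written
as matrices in that basis: positive semidefinite and of trace one. -/
def State (n : Type*) [Fintype n] : Type _ :=
  {ρ : Matrix n n ℂ // ρ.PosSemidef ∧ ρ.trace = 1}

/-- A POVM with outcomes in the finite type `J`: positive semidefinite operators that sum to the
identity. -/
def IsPOVM {n J : Type*} [Fintype n] [DecidableEq n] [Fintype J] (D : J → Matrix n n ℂ) : Prop :=
  (∀ j, (D j).PosSemidef) ∧ ∑ j, D j = 1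

/-- A CCQ channel, not necessarily memoryless: an arbitrary family of maps
`W k : X ^ k × Y ^ k → S(H^{⊗ k})`. Here `H` is the Hilbert space with orthonormal basis `d`,
so that `H^{⊗ k}` has the product basis `Fin k → d`. -/
def Channel (X Y d : Type*) [Fintype d] : Type _ :=
  (k : ℕ) → (Fin k → X) → (Fin k → Y) → State (Fin k → d)

/-- A `(k, M, N)`-code with stochastic encoders: `P m` is a probability distribution on `X ^ k`,
`Q n` is a probability distribution on `Y ^ k`, and `D` is a POVM on `H^{⊗ k}` indexed by pairs of
messages. -/
structure StochCode (X Y d : Type*) [Fintype X] [Fintype Y] [Fintype d] [DecidableEq d]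
    (k M N : ℕ) where
  P : Fin M → stdSimplex ℝ (Fin k → X)
  Q : Fin N → stdSimplex ℝ (Fin k → Y)
  D : Fin M × Fin N → Matrix (Fin k → d) (Fin k → d) ℂ
  povm : IsPOVM D

/-- A `(k, M, N)`-code with deterministic encoders: the messages `m` and `n` are sent as the
codewords `x m` and `y n`. -/
structure DetCode (X Y d : Type*) [Fintype d] [DecidableEq d] (k M N : ℕ) where
  x : Fin M → (Fin k → X)
  y : Fin N → (Fin k → Y)
  D : Fin M × Fin N → Matrix (Fin k → d) (Fin k → d) ℂ
  povm : IsPOVM D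

section

variable {X Y d : Type*} [Fintype d] [DecidableEq d]

/-- The probability `tr (D_{mn} W^k(x^k, y^k))` of decoding the pair `p = (m, n)` when `(x^k, y^k)`
is sent. The trace of a product of two positive semidefinite matrices is real. -/
def decodeProb (W : Channel X Y d) {k : ℕ} {J : Type*}
    (D : J → Matrix (Fin k → d) (Fin k → d) ℂ) (p : J) (x : Fin k → X) (y : Fin k → Y) : ℝ :=
  (D p * (W k x y).1).trace.re

/-- The maximal error probability of a code with stochastic encoders. -/
def StochCode.maxError [Fintype X] [Fintype Y] {k M N : ℕ} (C : StochCode X Y d k M N)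
    (W : Channel X Y d) : ℝ :=
  ⨆ p : Fin M × Fin N,
    (1 - ∑ x : Fin k → X, ∑ y : Fin k → Y,
      (C.P p.1).1 x * (C.Q p.2).1 y * decodeProb W C.D p x y)

/-- The average error probability of a code with deterministic encoders. -/
def DetCode.avgError {k M N : ℕ} (C : DetCode X Y d k M N) (W : Channel X Y d) : ℝ :=
  1 - (1 / ((M : ℝ) * (N : ℝ))) *
    ∑ m : Fin M, ∑ n : Fin N, decodeProb W C.D (m, n) (C.x m) (C.y n)

/-- The capacity region for codes with stochastic encoders under the maximal error. -/
def stochRegion [Fintype X] [Fintype Y] (W : Channel X Y d) : Set (ℝ × ℝ) :=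
  {R | 0 ≤ R.1 ∧ 0 ≤ R.2 ∧
    ∀ ε : ℝ, 0 < ε → ∀ δ : ℝ, 0 < δ → ∃ k₀ : ℕ, ∀ k : ℕ, k₀ ≤ k →
      ∃ M N : ℕ, 0 < M ∧ 0 < N ∧ ∃ C : StochCode X Y d k M N,
        R.1 - δ ≤ (1 / (k : ℝ)) * Real.logb 2 (M : ℝ) ∧
        R.2 - δ ≤ (1 / (k : ℝ)) * Real.logb 2 (N : ℝ) ∧
        C.maxError W ≤ ε}

/-- The capacity region for codes with deterministic encoders under the average error. -/
def detRegion (W : Channel X Y d) : Set (ℝ × ℝ) :=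
  {R | 0 ≤ R.1 ∧ 0 ≤ R.2 ∧
    ∀ ε : ℝ, 0 < ε → ∀ δ : ℝ, 0 < δ → ∃ k₀ : ℕ, ∀ k : ℕ, k₀ ≤ k →
      ∃ M N : ℕ, 0 < M ∧ 0 < N ∧ ∃ C : DetCode X Y d k M N,
        R.1 - δ ≤ (1 / (k : ℝ)) * Real.logb 2 (M : ℝ) ∧
        R.2 - δ ≤ (1 / (k : ℝ)) * Real.logb 2 (N : ℝ) ∧
        C.avgError W ≤ ε}

end

end CCQ

end

/-!
Subtracting the success probabilities of a deterministic code from `1` gives an error matrix with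
entries in `[0, 1]` and small mean. A stochastic encoder may replace a single column by the uniform
mixture of a block of columns, with a decoder that reports only the block, so it is enough to find
a set of rows and a partition of the columns into blocks such that in each of these rows every
block has small mean error.

By Markov's inequality at least half of the rows have small mean; only these are kept, and their
encoders stay deterministic (`exists_good_rows`). The columns are then split into `N'` blocks by a
map chosen uniformly at random. A Chernoff bound shows that a given row and block fail with
probability at most `exp (-2 η N / N')`, and the union bound over `M' N'` pairs leaves a map with
no failure (`exists_partition`). Since a rate loss `δ` leaves the blocks exponentially long in the
block length `k`, while `M' N'` is only exponential in `k`, the union bound succeeds for large `k`.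
The passage from a good map to a stochastic code is `exists_stochCode`.

A rate may be so small that the rate loss makes it nonpositive. One message is then enough, and the
single block of all columns has small mean in each good row without any randomness.
-/

namespace CCQ

/-! ### Measurement probabilities and coarse-grained measurements -/

theorem trace_mul_re_nonneg {n : Type*} [Fintype n] [DecidableEq n] {A B : Matrix n n ℂ}
    (hA : A.PosSemidef) (hB : B.PosSemidef) : 0 ≤ (A * B).trace.re := by
  open scoped MatrixOrder in
  obtain ⟨C, rfl⟩ := CStarAlgebra.nonneg_iff_eq_star_mul_self.mp hA.nonneg
  rw [Matrix.mul_assoc, Matrix.trace_mul_comm]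
  exact (Complex.le_def.mp (hB.mul_mul_conjTranspose_same C).trace_nonneg).1

section DecodeProb

variable {X Y d J K : Type*} [Fintype d] [DecidableEq d] [Fintype J]
  [DecidableEq K] {k : ℕ} (W : Channel X Y d) {D : J → Matrix (Fin k → d) (Fin k → d) ℂ}
  (x : Fin k → X) (y : Fin k → Y)

theorem decodeProb_nonneg (hD : IsPOVM D) (p : J) : 0 ≤ decodeProb W D p x y :=
  trace_mul_re_nonneg (hD.1 p) (W k x y).2.1

theorem sum_decodeProb (hD : IsPOVM D) : ∑ p, decodeProb W D p x y = 1 := by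
  simp only [decodeProb]
  rw [← Complex.re_sum, ← Matrix.trace_sum, ← Finset.sum_mul, hD.2, one_mul, (W k x y).2.2,
    Complex.one_re]

theorem decodeProb_le_one (hD : IsPOVM D) (p : J) : decodeProb W D p x y ≤ 1 :=
  sum_decodeProb W x y hD ▸ Finset.single_le_sum
    (f := fun q => decodeProb W D q x y) (fun q _ => decodeProb_nonneg W x y hD q)
    (Finset.mem_univ p)

/-- The operators of the measurement that performs `D` and reports only the value of `f` at the
outcome. -/
def coarsen (D : J → Matrix (Fin k → d) (Fin k → d) ℂ) (f : J → K) :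
    K → Matrix (Fin k → d) (Fin k → d) ℂ :=
  fun p => ∑ q with f q = p, D q

theorem IsPOVM.coarsen [Fintype K] (hD : IsPOVM D) (f : J → K) : IsPOVM (coarsen D f) := by
  refine ⟨fun p => Matrix.posSemidef_sum _ fun q _ => hD.1 q, ?_⟩
  rw [← hD.2]
  exact Finset.sum_fiberwise _ f D

theorem decodeProb_le_coarsen (hD : IsPOVM D) (f : J → K) {q : J} {p : K} (h : f q = p) :
    decodeProb W D q x y ≤ decodeProb W (coarsen D f) p x y := by
  have : decodeProb W (coarsen D f) p x y = ∑ q with f q = p, decodeProb W D q x y := by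
    simp only [decodeProb, CCQ.coarsen, Finset.sum_mul, Matrix.trace_sum, Complex.re_sum]
  rw [this]
  exact Finset.single_le_sum (f := fun q => decodeProb W D q x y)
    (fun q _ => decodeProb_nonneg W x y hD q) (by simp [h])

end DecodeProb

/-! ### From a partition of the columns to a stochastic code -/

/-- The distribution of `c n` for `n` uniformly distributed on the nonempty finite set `B`. -/
noncomputable def uniformOn {ι A : Type*} [Fintype A] [DecidableEq A] (B : Finset ι) (hB : B.Nonempty)
    (c : ι → A) : stdSimplex ℝ A :=
  ⟨fun a => (B.card : ℝ)⁻¹ * ∑ n ∈ B, if c n = a then 1 else 0, fun a => by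
    dsimp only; positivity, by
    rw [← Finset.mul_sum, Finset.sum_comm]
    have : (B.card : ℝ) ≠ 0 := by exact_mod_cast hB.card_pos.ne'
    simp [this]⟩

theorem sum_uniformOn_mul {ι A : Type*} [Fintype A] [DecidableEq A] (B : Finset ι)
    (hB : B.Nonempty) (c : ι → A) (F : A → ℝ) :
    ∑ a, (uniformOn B hB c).1 a * F a = (B.card : ℝ)⁻¹ * ∑ n ∈ B, F (c n) := by
  simp only [uniformOn, mul_assoc, Finset.sum_mul]
  rw [← Finset.mul_sum, Finset.sum_comm]
  simp

/-- If in every selected row `r i` each block `g ⁻¹ {j}` has mean error below `a`, then sending a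
uniformly random column of block `j` gives maximal error at most `a`. The strict inequality also
guarantees that no block is empty. -/
theorem exists_stochCode {X Y d : Type*} [Fintype X] [Fintype Y] [Fintype d] [DecidableEq d]
    (W : Channel X Y d) {k M N M' N' : ℕ} (C : DetCode X Y d k M N) (hM' : 0 < M') (hN' : 0 < N')
    (r : Fin M' → Fin M) (hr : r.Injective) (g : Fin N → Fin N') {a : ℝ}
    (h : ∀ i j, ∑ n with g n = j, (1 - decodeProb W C.D (r i, n) (C.x (r i)) (C.y n) - a) < 0) :
    ∃ C' : StochCode X Y d k M' N', C'.maxError W ≤ a := by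
  classical
  have : Nonempty (Fin M') := ⟨⟨0, hM'⟩⟩
  have : Nonempty (Fin N') := ⟨⟨0, hN'⟩⟩
  have hne : ∀ j, (Finset.univ.filter fun n => g n = j).Nonempty := fun j =>
    Finset.nonempty_of_sum_ne_zero (h (Classical.arbitrary _) j).ne
  refine ⟨⟨fun i => uniformOn {i} (Finset.singleton_nonempty i) fun i => C.x (r i),
    fun j => uniformOn _ (hne j) C.y,
    coarsen C.D fun q => (r.invFun q.1, g q.2), C.povm.coarsen _⟩, ?_⟩
  -- Outcomes in unselected rows are reported as an arbitrary message, which can only help.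
  refine ciSup_le fun ⟨i, j⟩ => ?_
  simp only [mul_assoc, ← Finset.mul_sum, sum_uniformOn_mul, Finset.card_singleton,
    Finset.sum_singleton, Nat.cast_one, inv_one, one_mul]
  have hpos : (0 : ℝ) < (Finset.univ.filter fun n => g n = j).card := by
    exact_mod_cast (hne j).card_pos
  have hle : ∑ n with g n = j, decodeProb W C.D (r i, n) (C.x (r i)) (C.y n) ≤
      ∑ n with g n = j, decodeProb W (coarsen C.D fun q => (r.invFun q.1, g q.2)) (i, j)
        (C.x (r i)) (C.y n) := by
    refine Finset.sum_le_sum fun n hn => decodeProb_le_coarsen W _ _ C.povm _ ?_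
    simp [Function.leftInverse_invFun hr i, (Finset.mem_filter.mp hn).2]
  have hij := h i j
  simp only [Finset.sum_sub_distrib, Finset.sum_const, nsmul_eq_mul, mul_one] at hij
  rw [sub_le_comm, inv_mul_eq_div, le_div_iff₀ hpos]
  linarith

/-! ### Selecting rows and partitioning columns -/

theorem exp_sub_one_le {e a : ℝ} (he : 0 ≤ e) (he1 : e ≤ 1) (ha : 0 ≤ a) (ha1 : a ≤ 1 / 2) :
    Real.exp (e - a) - 1 ≤ 2 * e - a / 2 := by
  have := (abs_le.mp (Real.abs_exp_sub_one_sub_id_le (x := e - a)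
    (abs_le.mpr ⟨by linarith, by linarith⟩))).2
  nlinarith [mul_nonneg he ha, mul_nonneg he (sub_nonneg.mpr he1),
    mul_nonneg ha (sub_nonneg.mpr ha1)]

/-- If every row of an error matrix has mean at most `η`, then the columns can be partitioned into
`N'` blocks on each of which every row has mean below `8 η`. The proof bounds, summed over all maps
`g`, rows and blocks, the exponentials of the sums in the conclusion by less than the number of
maps; so some `g` makes all of its exponentials less than `1`. -/
theorem exists_partition {I : Type*} [Fintype I] {N N' : ℕ} (hN' : 0 < N') (e : I → Fin N → ℝ)
    (he : ∀ i n, 0 ≤ e i n) (he1 : ∀ i n, e i n ≤ 1) {η : ℝ} (hη : 0 ≤ η) (hη1 : η ≤ 1 / 16)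
    (hrow : ∀ i, ∑ n, e i n ≤ η * N)
    (hcard : (Fintype.card I : ℝ) * N' < Real.exp (2 * η * (N / N'))) :
    ∃ g : Fin N → Fin N', ∀ i j, ∑ n with g n = j, (e i n - 8 * η) < 0 := by
  have hN'R : (0 : ℝ) < N' := by exact_mod_cast hN'
  -- `Z g i j` is the exponential of the sum that has to be negative.
  set Z : (Fin N → Fin N') → I → Fin N' → ℝ := fun g i j =>
    ∏ n, if g n = j then Real.exp (e i n - 8 * η) else 1 with hZ
  have hZexp : ∀ g i j, Z g i j = Real.exp (∑ n with g n = j, (e i n - 8 * η)) := by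
    intro g i j
    rw [Real.exp_sum, Finset.prod_filter]
  have hmoment : ∀ i j, ∑ g, Z g i j ≤ (N' : ℝ) ^ N * Real.exp (-(2 * η * (N / N'))) := by
    intro i j
    -- The values `g n` are independent, so the moment factors over `n`.
    have h1 : ∑ g, Z g i j = ∏ n : Fin N, ((N' : ℝ) + (Real.exp (e i n - 8 * η) - 1)) := by
      rw [hZ]
      have := Finset.prod_univ_sum (fun _ : Fin N => (Finset.univ : Finset (Fin N')))
        (fun n l => if l = j then Real.exp (e i n - 8 * η) else 1)
      rw [Fintype.piFinset_univ] at this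
      rw [← this]
      refine Finset.prod_congr rfl fun n _ => ?_
      have : ∀ l, (if l = j then Real.exp (e i n - 8 * η) else 1) =
          1 + if l = j then Real.exp (e i n - 8 * η) - 1 else 0 := by
        intro l; split_ifs <;> ring
      simp [this, Finset.sum_add_distrib]
    have hN'1 : (1 : ℝ) ≤ N' := by exact_mod_cast hN'
    calc ∑ g, Z g i j = ∏ n : Fin N, ((N' : ℝ) + (Real.exp (e i n - 8 * η) - 1)) := h1
      _ ≤ ∏ n : Fin N, ((N' : ℝ) * Real.exp ((2 * e i n - 4 * η) / N')) := by
        refine Finset.prod_le_prod (fun n _ => ?_) fun n _ => ?_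
        · have := Real.exp_pos (e i n - 8 * η); linarith
        · have h2 := exp_sub_one_le (he i n) (he1 i n) (a := 8 * η) (by linarith) (by linarith)
          have h3 := mul_le_mul_of_nonneg_left
            (Real.add_one_le_exp ((2 * e i n - 4 * η) / N')) hN'R.le
          rw [mul_add, mul_div_cancel₀ _ hN'R.ne'] at h3
          linarith
      _ = (N' : ℝ) ^ N * Real.exp ((2 * ∑ n, e i n - 4 * η * N) / N') := by
        rw [Finset.prod_mul_distrib, ← Real.exp_sum, ← Finset.sum_div, Finset.sum_sub_distrib,
          ← Finset.mul_sum]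
        simp [mul_comm]
      _ ≤ (N' : ℝ) ^ N * Real.exp (-(2 * η * (N / N'))) := by
        gcongr
        rw [← mul_div_assoc, ← neg_div]
        gcongr
        linarith [hrow i]
  have htot : ∑ g, ∑ i, ∑ j, Z g i j < ∑ _g : Fin N → Fin N', (1 : ℝ) := by
    calc ∑ g, ∑ i, ∑ j, Z g i j = ∑ i, ∑ j, ∑ g, Z g i j := by
          rw [Finset.sum_comm]
          exact Finset.sum_congr rfl fun i _ => Finset.sum_comm
      _ ≤ ∑ _i : I, ∑ _j : Fin N', (N' : ℝ) ^ N * Real.exp (-(2 * η * (N / N'))) :=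
          Finset.sum_le_sum fun i _ => Finset.sum_le_sum fun j _ => hmoment i j
      _ = (N' : ℝ) ^ N * ((Fintype.card I : ℝ) * N' * Real.exp (-(2 * η * (N / N')))) := by
          simp; ring
      _ < (N' : ℝ) ^ N * 1 := by
          gcongr
          rw [Real.exp_neg, ← div_eq_mul_inv, div_lt_one (Real.exp_pos _)]
          exact hcard
      _ = ∑ _g : Fin N → Fin N', (1 : ℝ) := by simp
  obtain ⟨g, -, hg⟩ := Finset.exists_lt_of_sum_lt htot
  refine ⟨g, fun i j => ?_⟩
  rw [← Real.exp_lt_one_iff, ← hZexp]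
  have hZ0 : ∀ i j, 0 ≤ Z g i j := fun i j => by rw [hZexp]; positivity
  calc Z g i j ≤ ∑ j, Z g i j := Finset.single_le_sum (fun j _ => hZ0 i j) (Finset.mem_univ j)
    _ ≤ ∑ i, ∑ j, Z g i j := Finset.single_le_sum (f := fun i => ∑ j, Z g i j)
        (fun i _ => Finset.sum_nonneg fun j _ => hZ0 i j) (Finset.mem_univ i)
    _ < 1 := hg

/-- Markov's inequality for the row means: at least half of the rows have at most twice the mean of
the whole matrix. -/
theorem exists_good_rows {M N : ℕ} (e : Fin M → Fin N → ℝ) (he : ∀ m n, 0 ≤ e m n) {η : ℝ}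
    (hη : 0 < η) (hN : 0 < N) (hsum : ∑ m, ∑ n, e m n ≤ η / 2 * (M * N)) {M' : ℕ}
    (hM' : 2 * M' ≤ M + 1) :
    ∃ r : Fin M' → Fin M, r.Injective ∧ ∀ i, ∑ n, e (r i) n ≤ η * N := by
  classical
  have hNR : (0 : ℝ) < N := by exact_mod_cast hN
  set G : Finset (Fin M) := {m | ∑ n, e m n ≤ η * N} with hG
  have hbad : (Gᶜ.card : ℝ) * (η * N) ≤ η / 2 * (M * N) := by
    refine le_trans ?_ hsum
    calc (Gᶜ.card : ℝ) * (η * N) = ∑ _m ∈ Gᶜ, η * N := by simp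
      _ ≤ ∑ m ∈ Gᶜ, ∑ n, e m n := Finset.sum_le_sum fun m hm => by
          simp only [hG, Finset.mem_compl, Finset.mem_filter_univ, not_le] at hm
          exact hm.le
      _ ≤ ∑ m, ∑ n, e m n := Finset.sum_le_univ_sum_of_nonneg fun m =>
          Finset.sum_nonneg fun n _ => he m n
  have hbad2 : 2 * Gᶜ.card ≤ M := by
    have : (2 * Gᶜ.card : ℝ) * (η * N) ≤ M * (η * N) := by linarith
    exact_mod_cast le_of_mul_le_mul_right this (by positivity)
  have hcard : M' ≤ G.card := by
    have := G.card_add_card_compl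
    rw [Fintype.card_fin] at this
    omega
  refine ⟨fun i => (G.orderEmbOfFin rfl (Fin.castLE hcard i)), fun i j hij => ?_, fun i => ?_⟩
  · simpa using hij
  · have := G.orderEmbOfFin_mem rfl (Fin.castLE hcard i)
    exact (Finset.mem_filter.mp this).2

/-- A deterministic code with small average error yields a stochastic code with small maximal error,
for any smaller message counts that meet the union bound or with a single block. -/
theorem exists_stochCode_of_avgError {X Y d : Type*} [Fintype X] [Fintype Y] [Fintype d]
    [DecidableEq d] (W : Channel X Y d) {k M N M' N' : ℕ} (C : DetCode X Y d k M N) (hM : 0 < M)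
    (hN : 0 < N) (hM' : 0 < M') (hN' : 0 < N') {η : ℝ} (hη : 0 < η) (hη1 : η ≤ 1 / 16)
    (hC : C.avgError W ≤ η / 2) (hMM' : 2 * M' ≤ M + 1)
    (hNN' : N' = 1 ∨ (M' : ℝ) * N' < Real.exp (2 * η * (N / N'))) :
    ∃ C' : StochCode X Y d k M' N', C'.maxError W ≤ 8 * η := by
  have hMR : (0 : ℝ) < M := by exact_mod_cast hM
  have hNR : (0 : ℝ) < N := by exact_mod_cast hN
  set e : Fin M → Fin N → ℝ := fun m n => 1 - decodeProb W C.D (m, n) (C.x m) (C.y n) with he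
  have he0 : ∀ m n, 0 ≤ e m n := fun m n => sub_nonneg.mpr (decodeProb_le_one W _ _ C.povm _)
  have he1 : ∀ m n, e m n ≤ 1 := fun m n => sub_le_self _ (decodeProb_nonneg W _ _ C.povm _)
  have hsum : ∑ m, ∑ n, e m n ≤ η / 2 * (M * N) := by
    rw [DetCode.avgError, one_div_mul_eq_div, sub_le_iff_le_add, ← sub_le_iff_le_add',
      le_div_iff₀ (by positivity)] at hC
    simp only [he, Finset.sum_sub_distrib, Finset.sum_const, Finset.card_univ, Fintype.card_fin,
      nsmul_eq_mul, mul_one]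
    linarith
  obtain ⟨r, hr, hrow⟩ := exists_good_rows e he0 hη hN hsum hMM'
  obtain ⟨g, hg⟩ : ∃ g : Fin N → Fin N', ∀ i j, ∑ n with g n = j, (e (r i) n - 8 * η) < 0 := by
    rcases hNN' with rfl | h
    · refine ⟨fun _ => 0, fun i j => ?_⟩
      have : (Finset.univ.filter fun _ : Fin N => (0 : Fin 1) = j) = Finset.univ := by
        simp [Subsingleton.elim (0 : Fin 1) j]
      rw [this, Finset.sum_sub_distrib]
      simp only [Finset.sum_const, Finset.card_univ, Fintype.card_fin, nsmul_eq_mul]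
      nlinarith [hrow i, mul_pos hη hNR]
    · exact exists_partition hN' (fun i => e (r i)) (fun i => he0 _) (fun i => he1 _) hη.le hη1
        hrow (by simpa using h)
  exact exists_stochCode W C hM' hN' r hr g hg

/-! ### Message counts of given rates -/

/-- The number of messages `⌈2 ^ (k S)⌉` of a code of block length `k` and rate `S`. -/
noncomputable def messageCount (k : ℕ) (S : ℝ) : ℕ := ⌈(2 : ℝ) ^ (k * S)⌉₊

theorem messageCount_pos (k : ℕ) (S : ℝ) : 0 < messageCount k S :=
  Nat.ceil_pos.mpr (by positivity)

theorem le_logb_messageCount {k : ℕ} (hk : 0 < k) (S : ℝ) :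
    S ≤ 1 / (k : ℝ) * Real.logb 2 (messageCount k S) := by
  have hkR : (0 : ℝ) < k := by exact_mod_cast hk
  rw [one_div_mul_eq_div, le_div_iff₀ hkR, Real.le_logb_iff_rpow_le (by norm_num)
    (by exact_mod_cast messageCount_pos k S), mul_comm S]
  exact Nat.le_ceil _

theorem messageCount_le {k : ℕ} {S T : ℝ} (hST : S ≤ T) (hT : 0 ≤ T) :
    (messageCount k S : ℝ) ≤ 2 * 2 ^ (k * T) := by
  have h1 : (1 : ℝ) ≤ 2 ^ (k * T) := Real.one_le_rpow (by norm_num) (by positivity)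
  have h2 : (2 : ℝ) ^ (k * S) ≤ 2 ^ (k * T) :=
    Real.rpow_le_rpow_of_exponent_le (by norm_num) (by gcongr)
  have := (Nat.ceil_lt_add_one (a := (2 : ℝ) ^ (k * S)) (by positivity)).le
  rw [messageCount]
  linarith

/-- Lowering a rate by `δ / 2` makes the number of messages exponentially smaller, unless rounding
up leaves a single message. -/
theorem messageCount_eq_one_or {k M : ℕ} (hk : 0 < k) (hM : 0 < M) {R δ : ℝ}
    (hR : R - δ / 2 ≤ 1 / (k : ℝ) * Real.logb 2 M) :
    messageCount k (R - δ) = 1 ∨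
      (messageCount k (R - δ) : ℝ) * ((2 : ℝ) ^ (δ / 2)) ^ k ≤ 2 * M := by
  have hkR : (0 : ℝ) < k := by exact_mod_cast hk
  rcases le_or_gt (R - δ) 0 with h | h
  · left
    refine le_antisymm (Nat.ceil_le.mpr ?_) (messageCount_pos _ _)
    rw [Nat.cast_one]
    exact Real.rpow_le_one_of_one_le_of_nonpos (by norm_num)
      (mul_nonpos_of_nonneg_of_nonpos hkR.le h)
  · right
    rw [one_div_mul_eq_div, le_div_iff₀ hkR, Real.le_logb_iff_rpow_le (by norm_num)
      (by exact_mod_cast hM)] at hR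
    calc (messageCount k (R - δ) : ℝ) * ((2 : ℝ) ^ (δ / 2)) ^ k
        ≤ 2 * 2 ^ (k * (R - δ)) * ((2 : ℝ) ^ (δ / 2)) ^ k := by
          gcongr; exact messageCount_le le_rfl h.le
      _ = 2 * 2 ^ ((R - δ / 2) * k) := by
          rw [← Real.rpow_natCast, ← Real.rpow_mul (by norm_num), mul_assoc,
            ← Real.rpow_add (by norm_num)]
          ring_nf
      _ ≤ 2 * M := by gcongr

end CCQ

/-! ### Comparison of the capacity regions -/

theorem theorem3 {X Y d : Type*} [Fintype X] [Fintype Y] [Fintype d] [DecidableEq d]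
    (W : CCQ.Channel X Y d) : CCQ.detRegion W ⊆ CCQ.stochRegion W := by
  open CCQ in
  rintro ⟨R₁, R₂⟩ ⟨hR₁, hR₂, H⟩
  refine ⟨hR₁, hR₂, fun ε hε δ hδ => ?_⟩
  dsimp only at hR₁ hR₂ H ⊢
  -- The stochastic code has maximal error at most `8 η`;
  -- the Chernoff bound needs `8 η ≤ 1 / 2`.
  set η : ℝ := min ε 1 / 16 with hη
  have hη0 : 0 < η := by positivity
  have hη1 : η ≤ 1 / 16 := by rw [hη]; gcongr; exact min_le_right _ _
  have hηε : 8 * η ≤ ε := by rw [hη]; linarith [min_le_left ε 1]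
  obtain ⟨k₁, hk₁⟩ := H (η / 2) (by positivity) (δ / 2) (by positivity)
  -- `b ^ k` is up to a factor the length of the blocks; it has to dominate `log (M' N') = O(k)`.
  set b : ℝ := 2 ^ (δ / 2) with hb
  have hb1 : 1 < b := Real.one_lt_rpow (by norm_num) (by positivity)
  have hlin := (isLittleO_coe_const_pow_of_one_lt (R := ℝ) hb1).bound
    (c := η / (R₁ + R₂ + 3)) (by positivity)
  obtain ⟨k₂, hk₂⟩ := Filter.eventually_atTop.mp
    (hlin.and ((tendsto_pow_atTop_atTop_of_one_lt hb1).eventually_ge_atTop 4))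
  refine ⟨max k₁ (max k₂ 1), fun k hk => ?_⟩
  have hk0 : 0 < k := by omega
  have hk1R : (1 : ℝ) ≤ k := by exact_mod_cast hk0
  obtain ⟨M, N, hM, hN, C, hRM, hRN, hC⟩ := hk₁ k (by omega)
  obtain ⟨hkb, hb4⟩ := hk₂ k (by omega)
  have hMM' := messageCount_eq_one_or hk0 hM hRM
  have hNN' := messageCount_eq_one_or hk0 hN hRN
  have hM'0 := messageCount_pos k (R₁ - δ)
  have hN'0 := messageCount_pos k (R₂ - δ)
  have hM'R := le_logb_messageCount hk0 (R₁ - δ)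
  have hN'R := le_logb_messageCount hk0 (R₂ - δ)
  have hM'le := messageCount_le (k := k) (sub_le_self R₁ hδ.le) hR₁
  have hN'le := messageCount_le (k := k) (sub_le_self R₂ hδ.le) hR₂
  rw [← hb] at hMM' hNN'
  generalize messageCount k (R₁ - δ) = M' at *
  generalize messageCount k (R₂ - δ) = N' at *
  have hN'0R : (0 : ℝ) < N' := by exact_mod_cast hN'0
  have hrows : 2 * M' ≤ M + 1 := by
    rcases hMM' with rfl | h
    · omega
    · have : (2 * M' : ℝ) ≤ M := by
        nlinarith [mul_le_mul_of_nonneg_left hb4 (Nat.cast_nonneg (α := ℝ) M')]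
      have : 2 * M' ≤ M := by exact_mod_cast this
      omega
  have hblocks : N' = 1 ∨ (M' : ℝ) * N' < Real.exp (2 * η * (N / N')) := by
    refine hNN'.imp_right fun h => ?_
    have hkb' : k * (R₁ + R₂ + 3) ≤ η * b ^ k := by
      rw [Real.norm_natCast, Real.norm_of_nonneg (by positivity), div_mul_eq_mul_div,
        le_div_iff₀ (by positivity)] at hkb
      exact hkb
    have hlog : Real.log 2 ≤ 1 := by linarith [Real.log_two_lt_d9]
    calc (M' : ℝ) * N' ≤ (2 * 2 ^ (k * R₁)) * (2 * 2 ^ (k * R₂)) := by gcongr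
      _ = 2 ^ (k * (R₁ + R₂) + 2) := by
        rw [Real.rpow_add (by norm_num), mul_add, Real.rpow_add (by norm_num)]
        norm_num; ring
      _ = Real.exp (Real.log 2 * (k * (R₁ + R₂) + 2)) := by
        rw [Real.rpow_def_of_pos (by norm_num)]
      _ < Real.exp (2 * η * (N / N')) := by
        refine Real.exp_lt_exp.mpr ?_
        have h1 : b ^ k ≤ 2 * (N / N') := by
          rw [← mul_div_assoc, le_div_iff₀ hN'0R]; linarith
        have h2 : 0 ≤ k * (R₁ + R₂) + 2 := by positivity
        nlinarith [mul_le_mul_of_nonneg_right hlog h2, mul_le_mul_of_nonneg_left h1 hη0.le]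
  obtain ⟨C', hC'⟩ := exists_stochCode_of_avgError W C hM hN hM'0 hN'0 hη0 hη1 hC hrows hblocks
  exact ⟨M', N', hM'0, hN'0, C', hM'R, hN'R, hC'.trans hηε⟩
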